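/- **Mean-based algorithms converge to strategy profiles in the serially undominated set.** *Game.* Let a finite normal-form game have players $i\in\mathcal N$ (finitely many), finite action sets $\mathcal A_i$, $\mathcal A=\prod_i\mathcal A_i$, and payoffs $u_i:\mathcal A\to\mathbb R$. Put $S^0_i=\mathcal A_i$ and let $S^{k+1}_i$ consist of those $a_i\in S^k_i$ for which there is no mixed strategy $x\in\Delta(S^k_i)$ with $u_i(x,b_{-i})>u_i(a_i,b_{-i})$ for all $b_{-i}\in\prod_{j\ne i}S^k_j$. The (strictly) serially undominated set is $\bar{\mathcal A}=\prod_i\bar{\mathcal A}_i$ with $\bar{\mathcal A}_i=\bigcap_k S^k_i$. *Algorithms.* An online algorithm for player $i$ assigns to every history of $r\ge 0$ rounds (in each round $s$ the player's own action and the reward function $r_s:\mathcal A_i\to\mathbb R$ of that round) a probability distribution on $\mathcal A_i$, the law of the action in round $r+1$; bandit algorithms are those that use only the rewards of the actions played. Fix an interval $[\underline u,\overline u]$. For a history of length $r=t-1$ let $\alpha_t(a)=\frac1{t-1}\sum_{s=1}^{t-1}r_s(a)$ (and $\alpha_1=0$). The algorithm is *$\gamma_t$-mean-based* (for rewards in $[\underline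 u,\overline u]$) if for every $t\ge1$, every history of $t-1$ rounds with rewards in $[\underline u,\overline u]$ and every action $a$ such that $\alpha_t(a')-\alpha_t(a)>\gamma_t$ for some $a'$, the probability that it picks $a$ in round $t$ is at most $\gamma_t$. It is *mean-based* if this holds for some non-increasing sequence $(\gamma_t)_{t\ge1}$ with $\gamma_t\to0$. *Repeated play.* On a probability space, in rounds $t=1,2,\dots$ of the game the players choose a random action profile $a_t=(a_{i,t})_i$, and nature draws random payoffs $U_{i,t}(a)$, $i\in\mathcal N$, $a\in\mathcal A$. Player $i$ may have entered before the first round, and then starts with a (random) record of $m_i\ge0$ earlier rounds, whose reward functions take values in $[\underline u,\overline u]$ and are otherwise arbitrary. The history of player $i$ before round $t$ consists of these $m_i$ earlier rounds followed by the rounds $s=1,\dots,t-1$, with own action $a_{i,s}$ and reward function $b\mapsto U_{i,s}(b,a_{-i,s})$. Let $H_{t-1}$ be generated by the histories of all players before round $t$. Assume: 1. $U_{i,t}(a)\in[\underline u,\overline u]$ almost surely, $\mathbb E[U_{i,t}(a)]=u_i(a)$, and $U_{i,t}(a)$ is independent of $(H_{t-1},a_t)$ for all $i,t,a$ (e.g.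 payoffs that are drawn i.i.d. over time by nature, or deterministic payoffs $U_{i,t}=u_i$); 2. each player $i$ uses a mean-based algorithm (with its own sequence $\gamma_{i,t}$), i.e. $\mathbb P(a_{i,t}=a\mid H_{t-1})$ is the probability that the algorithm gives to $a$ at player $i$'s history before round $t$. *Conclusion.* Almost surely, the sequence of action profiles converges in time-average to the serially undominated set: $$\lim_{T\to\infty}\frac1T\sum_{t=1}^{T}\mathbb I\big[\forall i:\ a_{i,t}\in\bar{\mathcal A}_i\big]=1 .$$ -/

import Mathlib

open MeasureTheory ProbabilityTheory Filter Topology Set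

noncomputable section

namespace MeanBased

/-! ### Iterated strict dominance

A finite normal-form game is given by its payoffs `u i : (∀ j, A j) → ℝ`, one for each player
`i : ι`, with finite player set `ι` and finite action sets `A i`. -/

section Dominance

variable {ι : Type*} [DecidableEq ι] {A : ι → Type*} [∀ i, Fintype (A i)]

/-- `u_i(x, b_{-i})`: the expected payoff of player `i` for the mixed strategy `x` against the
pure actions `b_{-i}` of the others (the entry `b i` plays no role). -/
def mixedPayoff (u : (i : ι) → (∀ j, A j) → ℝ) (i : ι) (x : A i → ℝ) (b : ∀ j, A j) : ℝ :=
  ∑ c, x c * u i (Function.update b i c)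

/-- In the game restricted to the product set `S`, the action `a` of player `i` is strictly
dominated by a mixed strategy: some `x ∈ Δ(S i)` is strictly better than `a` against every
`b_{-i} ∈ S_{-i}`. -/
def StrictlyDominated (u : (i : ι) → (∀ j, A j) → ℝ) (S : (i : ι) → Set (A i)) (i : ι)
    (a : A i) : Prop :=
  ∃ x ∈ stdSimplex ℝ (A i), (∀ c, c ∉ S i → x c = 0) ∧
    ∀ b : ∀ j, A j, (∀ j, j ≠ i → b j ∈ S j) →
      u i (Function.update b i a) < mixedPayoff u i x b

/-- The actions of each player that are left after `k` rounds of iterated strict dominance. -/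
def survivors (u : (i : ι) → (∀ j, A j) → ℝ) : ℕ → (i : ι) → Set (A i)
  | 0 => fun _ => Set.univ
  | k + 1 => fun i => {a | a ∈ survivors u k i ∧ ¬ StrictlyDominated u (survivors u k) i a}

/-- The strictly serially undominated actions of player `i`. -/
def seriallyUndominated (u : (i : ι) → (∀ j, A j) → ℝ) (i : ι) : Set (A i) :=
  ⋂ k, survivors u k i

end Dominance

/-! ### Mean-based algorithms -/

section Algorithm

/-- An online algorithm with action set `A`. Given what happened in its first `r` rounds (in each
round its own action and the reward function `A → ℝ` of that round), it returns the distribution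
of its action in round `r + 1`. Algorithms with bandit feedback are those that use each reward
function only at the action that was played. -/
abbrev OnlineAlgorithm (A : Type*) [Fintype A] : Type _ :=
  (r : ℕ) → (Fin r → A × (A → ℝ)) → stdSimplex ℝ A

/-- The average reward of the action `a` over the `r` rounds of the history `h`. -/
def averageReward {A : Type*} {r : ℕ} (h : Fin r → A × (A → ℝ)) (a : A) : ℝ :=
  (∑ s, (h s).2 a) / r

/-- The algorithm is `γ`-mean-based, for rewards in `[lo, hi]`. Round `r + 1` is the one that
follows a history of `r` rounds. -/
def IsMeanBasedWith {A : Type*} [Fintype A] (lo hi : ℝ) (γ : ℕ → ℝ)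
    (alg : OnlineAlgorithm A) : Prop :=
  ∀ (r : ℕ) (h : Fin r → A × (A → ℝ)), (∀ s b, (h s).2 b ∈ Set.Icc lo hi) →
    ∀ a, (∃ a', averageReward h a' - averageReward h a > γ (r + 1)) →
      (alg r h).1 a ≤ γ (r + 1)

/-- The algorithm is mean-based, for rewards in `[lo, hi]`. -/
def IsMeanBased {A : Type*} [Fintype A] (lo hi : ℝ) (alg : OnlineAlgorithm A) : Prop :=
  ∃ γ : ℕ → ℝ, AntitoneOn γ (Set.Ici 1) ∧ Tendsto γ atTop (𝓝 0) ∧ IsMeanBasedWith lo hi γ alg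

end Algorithm

/-! ### Repeated play

Time is counted from `0`: `act t` is the action profile of the `(t + 1)`-st round of the game, and
`U t i a` is the payoff that player `i` would get in that round under the action profile `a`.
Player `i` may have entered earlier: `prior i` lists the actions and reward functions of the `m i`
rounds which that player went through before the game starts (`m i = 0` for no earlier entry). -/

section Play

variable {ι : Type*} [DecidableEq ι] {A : ι → Type*} {Ω : Type*}

/-- What player `i` has gone through before round `t + 1` of the game: the earlier rounds `prior i`,
then the own action `a_{i,s}` and the reward function `b ↦ U_{i,s}(b, a_{-i,s})` of each of the
first `t` rounds of the game. -/
def playerHistory {m : ι → ℕ} (prior : (i : ι) → Ω → Fin (m i) → A i × (A i → ℝ))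
    (U : ℕ → ι → (∀ j, A j) → Ω → ℝ) (act : ℕ → Ω → ∀ j, A j) (i : ι) (t : ℕ) (ω : Ω) :
    Fin (m i + t) → A i × (A i → ℝ) :=
  Fin.append (prior i ω) (fun s : Fin t =>
    (act s ω i, fun b => U s i (Function.update (act s ω) i b) ω))

variable [∀ i, MeasurableSpace (A i)]

/-- The σ-algebra generated by the histories of all players before round `t + 1`. -/
@[reducible] def past {m : ι → ℕ} (prior : (i : ι) → Ω → Fin (m i) → A i × (A i → ℝ))
    (U : ℕ → ι → (∀ j, A j) → Ω → ℝ) (act : ℕ → Ω → ∀ j, A j) (t : ℕ) : MeasurableSpace Ω :=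
  ⨆ i, MeasurableSpace.comap (playerHistory prior U act i t) inferInstance

/-- The random actions `act` are those of players who use the algorithms `alg` in the repeated game
with random payoffs `U`, whose expected payoffs are `u` and whose values lie in `[lo, hi]`.
Nature draws the payoffs of a round independently of the past and of the actions of that round.
Given the past, player `i` acts according to the distribution returned by `alg i`. -/
structure IsRepeatedPlay [∀ i, Fintype (A i)] [MeasurableSpace Ω] (μ : Measure Ω)
    (u : (i : ι) → (∀ j, A j) → ℝ) (lo hi : ℝ) (alg : (i : ι) → OnlineAlgorithm (A i))
    {m : ι → ℕ} (prior : (i : ι) → Ω → Fin (m i) → A i × (A i → ℝ))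
    (U : ℕ → ι → (∀ j, A j) → Ω → ℝ) (act : ℕ → Ω → ∀ j, A j) : Prop where
  measurable_prior : ∀ i, Measurable (prior i)
  measurable_payoff : ∀ t i a, Measurable (U t i a)
  measurable_action : ∀ t, Measurable (act t)
  prior_mem : ∀ i, ∀ᵐ ω ∂μ, ∀ s b, (prior i ω s).2 b ∈ Set.Icc lo hi
  payoff_mem : ∀ t i a, ∀ᵐ ω ∂μ, U t i a ω ∈ Set.Icc lo hi
  payoff_mean : ∀ t i a, ∫ ω, U t i a ω ∂μ = u i a
  payoff_indep : ∀ t i a, Indep (MeasurableSpace.comap (U t i a) inferInstance)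
    (past prior U act t ⊔ MeasurableSpace.comap (act t) inferInstance) μ
  action_law : ∀ t i a, μ⟦{ω | act t ω i = a} | past prior U act t⟧ =ᵐ[μ]
    fun ω => (alg i (m i + t) (playerHistory prior U act i t ω)).1 a

end Play

open Classical in
/-- The sequence of action profiles `a` converges in time-average to the product set `S`. -/
def TimeAverageConverges {ι : Type*} {A : ι → Type*} (a : ℕ → ∀ j, A j)
    (S : (i : ι) → Set (A i)) : Prop :=
  Tendsto (fun T : ℕ => (1 / (T : ℝ)) * ∑ t ∈ Finset.range T, if ∀ i, a t i ∈ S i then (1 : ℝ) else 0)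
    atTop (𝓝 1)

end MeanBased

end

/-! The proof is by induction on the rounds of elimination, and probability enters only through two
laws of large numbers. Realised rewards average out to the payoffs expected at the opponents' actual
actions (`ae_tendsto_average_reward_sub`), and the frequency of an action is asymptotically the
average of the probabilities that the algorithm gives it (`ae_tendsto_average_action_sub`). Both are
instances of the strong law for bounded martingale differences.

Outside a null set the rest is deterministic. If play is in `survivors u k` at asymptotic frequency
one, a mixed strategy that dominates `a` there gains a fixed margin in almost every round
(`StrictlyDominated.exists_margin`), and a bounded amount is lost in the others. So its cumulative
advantage grows linearly, and some pure action, at least as good as the mixture, beats `a` in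
average reward by more than `γ`. Being mean-based forces the probability of `a` to zero, hence its
frequency too. Finiteness makes the elimination stop after some `k` rounds, which ends the
induction. The rounds before entry are a fixed finite number and wash out in the averages. -/

namespace MeanBased

/-! ### A strong law of large numbers for bounded martingale differences -/

section StrongLaw

/-- A case of Kronecker's lemma. -/
theorem tendsto_average_zero_of_tendsto_sum_div {d : ℕ → ℝ} {c : ℝ}
    (h : Tendsto (fun n : ℕ => ∑ s ∈ Finset.range n, d s / (s + 1)) atTop (𝓝 c)) :
    Tendsto (fun n : ℕ => (∑ s ∈ Finset.range n, d s) / n) atTop (𝓝 0) := by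
  -- Summation by parts. After division by `n`, the two terms are the partial sum and the Cesàro
  -- mean of the partial sums, with the same limit.
  have key : ∀ n : ℕ, ∑ s ∈ Finset.range n, d s =
      n * (∑ s ∈ Finset.range n, d s / (s + 1)) -
        ∑ k ∈ Finset.range n, ∑ s ∈ Finset.range k, d s / ((s : ℝ) + 1) := by
    intro n
    induction n with
    | zero => simp
    | succ n ih =>
      rw [Finset.sum_range_succ, ih, Finset.sum_range_succ (fun s => d s / ((s : ℝ) + 1)),
        Finset.sum_range_succ (fun k => ∑ s ∈ Finset.range k, d s / ((s : ℝ) + 1))]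
      have : (n : ℝ) + 1 ≠ 0 := by positivity
      push_cast
      field_simp
      ring
  have h2 := h.sub h.cesaro
  rw [sub_self] at h2
  refine h2.congr' ?_
  filter_upwards [eventually_gt_atTop 0] with n hn
  have : (n : ℝ) ≠ 0 := by positivity
  rw [key n]
  field_simp

variable {Ω : Type*} {m0 : MeasurableSpace Ω} {μ : Measure Ω} [IsProbabilityMeasure μ]

/-- The weighted sums of `D s / (s + 1)` form a martingale bounded in L², since its increments are
orthogonal and `∑ C² / (s + 1)²` is finite. It converges almost surely, and Kronecker's lemma
applies. -/
theorem ae_tendsto_average_zero_of_condExp_eq_zero (ℱ : Filtration ℕ m0) {D : ℕ → Ω → ℝ} {C : ℝ}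
    (hmeas : ∀ n, StronglyMeasurable[ℱ (n + 1)] (D n)) (hbd : ∀ n, ∀ᵐ ω ∂μ, |D n ω| ≤ C)
    (hce : ∀ n, μ[D n | ℱ n] =ᵐ[μ] 0) :
    ∀ᵐ ω ∂μ, Tendsto (fun n : ℕ => (∑ s ∈ Finset.range n, D s ω) / n) atTop (𝓝 0) := by
  set M : ℕ → Ω → ℝ := fun n ω => ∑ s ∈ Finset.range n, D s ω / (s + 1) with hM
  have hMsucc : ∀ n, M (n + 1) = M n + ((n : ℝ) + 1)⁻¹ • D n := by
    intro n
    ext ω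
    simp [hM, Finset.sum_range_succ, div_eq_inv_mul]
  have hD0 : ∀ n, StronglyMeasurable (D n) := fun n => (hmeas n).mono (ℱ.le _)
  have hDint : ∀ n, Integrable (D n) μ := fun n =>
    Integrable.of_bound (hD0 n).aestronglyMeasurable C (hbd n)
  have hadapt : StronglyAdapted ℱ M := by
    intro n
    refine Finset.stronglyMeasurable_fun_sum _ fun s hs => ?_
    have : StronglyMeasurable[ℱ n] (D s) :=
      (hmeas s).mono (ℱ.mono (Finset.mem_range.1 hs))
    simpa only [div_eq_mul_inv] using this.mul_const ((s : ℝ) + 1)⁻¹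
  have hM0 : ∀ n, StronglyMeasurable (M n) := fun n => (hadapt n).mono (ℱ.le _)
  have hMbd : ∀ n, ∃ B, ∀ᵐ ω ∂μ, ‖M n ω‖ ≤ B := by
    intro n
    refine ⟨∑ s ∈ Finset.range n, C / (s + 1), ?_⟩
    filter_upwards [ae_all_iff.2 hbd] with ω h
    refine (norm_sum_le _ _).trans (Finset.sum_le_sum fun s _ => ?_)
    rw [Real.norm_eq_abs, abs_div, abs_of_pos (show (0 : ℝ) < s + 1 by positivity)]
    gcongr
    exact h s
  have hMint : ∀ n, Integrable (M n) μ := by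
    intro n
    obtain ⟨B, hB⟩ := hMbd n
    exact Integrable.of_bound (hM0 n).aestronglyMeasurable B hB
  have hmart : Martingale M ℱ μ := by
    refine martingale_nat hadapt hMint fun n => ?_
    rw [hMsucc]
    have h1 := condExp_add (hMint n) ((hDint n).smul ((n : ℝ) + 1)⁻¹) (ℱ n)
    have h2 := condExp_smul (μ := μ) ((n : ℝ) + 1)⁻¹ (D n) (ℱ n)
    have h3 := condExp_of_stronglyMeasurable (ℱ.le n) (hadapt n) (hMint n)
    filter_upwards [h1, h2, hce n] with ω e1 e2 e3
    rw [e1, Pi.add_apply, h3, e2, Pi.smul_apply, e3]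
    simp
  have hcross : ∀ n, ∫ ω, M n ω * D n ω ∂μ = 0 := by
    intro n
    obtain ⟨B, hB⟩ := hMbd n
    have h1 := condExp_stronglyMeasurable_mul_of_bound (ℱ.le n) (hadapt n) (hDint n) B hB
    have h2 : ∫ ω, (M n * D n) ω ∂μ = 0 := by
      rw [← integral_condExp (ℱ.le n), integral_congr_ae h1]
      refine integral_eq_zero_of_ae ?_
      filter_upwards [hce n] with ω e
      simp [e]
    exact h2
  have hMsq : ∀ n, Integrable (fun ω => M n ω ^ 2) μ := by
    intro n
    obtain ⟨B, hB⟩ := hMbd n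
    simpa only [sq] using (hMint n).bdd_mul (hM0 n).aestronglyMeasurable hB
  have hDsq : ∀ n, Integrable (fun ω => D n ω ^ 2) μ := by
    intro n
    simpa only [sq] using (hDint n).bdd_mul (hD0 n).aestronglyMeasurable (hbd n)
  have hMD : ∀ n, Integrable (fun ω => M n ω * D n ω) μ := by
    intro n
    obtain ⟨B, hB⟩ := hMbd n
    exact (hDint n).bdd_mul (hM0 n).aestronglyMeasurable hB
  have hsq : ∀ n, ∫ ω, M n ω ^ 2 ∂μ ≤ ∑ s ∈ Finset.range n, C ^ 2 * (1 / ((s + 1 : ℕ) : ℝ) ^ 2) := by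
    intro n
    induction n with
    | zero => simp [hM]
    | succ n ih =>
      rw [Finset.sum_range_succ]
      have e : ∀ ω, M (n + 1) ω ^ 2 = M n ω ^ 2 + 2 * ((n : ℝ) + 1)⁻¹ * (M n ω * D n ω) +
          (((n : ℝ) + 1)⁻¹) ^ 2 * D n ω ^ 2 := by
        intro ω
        rw [hMsucc]
        simp only [Pi.add_apply, Pi.smul_apply, smul_eq_mul]
        ring
      have hD2 : ∫ ω, D n ω ^ 2 ∂μ ≤ C ^ 2 := by
        calc ∫ ω, D n ω ^ 2 ∂μ ≤ ∫ _, C ^ 2 ∂μ := by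
              refine integral_mono_ae (hDsq n) (integrable_const _) ?_
              filter_upwards [hbd n] with ω h
              exact sq_le_sq' (abs_le.1 h).1 (abs_le.1 h).2
          _ = C ^ 2 := by simp
      simp_rw [e]
      have hMn : Integrable (fun ω => M n ω ^ 2 + 2 * ((n : ℝ) + 1)⁻¹ * (M n ω * D n ω)) μ :=
        (hMsq n).add ((hMD n).const_mul _)
      rw [integral_add hMn ((hDsq n).const_mul _),
        integral_add (hMsq n) ((hMD n).const_mul _), integral_const_mul, integral_const_mul,
        hcross n, mul_zero, add_zero]
      refine add_le_add ih ?_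
      rw [mul_comm (C ^ 2)]
      have : ((n : ℝ) + 1)⁻¹ ^ 2 = 1 / ((n + 1 : ℕ) : ℝ) ^ 2 := by
        push_cast
        rw [inv_pow, one_div]
      rw [this]
      gcongr
  have hsum : Summable fun s : ℕ => C ^ 2 * (1 / ((s + 1 : ℕ) : ℝ) ^ 2) :=
    ((summable_nat_add_iff 1).2 (Real.summable_one_div_nat_pow.2 one_lt_two)).mul_left _
  set R : ℝ := ∑' s : ℕ, C ^ 2 * (1 / ((s + 1 : ℕ) : ℝ) ^ 2)
  have hR : ∀ n, ∫ ω, M n ω ^ 2 ∂μ ≤ R := fun n =>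
    (hsq n).trans (hsum.sum_le_tsum _ fun s _ => by positivity)
  -- The convergence theorem asks for an L¹ bound, which follows from `|x| ≤ 1 + x²`.
  have hL1 : ∀ n, eLpNorm (M n) 1 μ ≤ ((1 + R).toNNReal : ENNReal) := by
    intro n
    rw [eLpNorm_one_eq_lintegral_enorm, ← ofReal_integral_norm_eq_lintegral_enorm (hMint n)]
    change _ ≤ ENNReal.ofReal (1 + R)
    refine ENNReal.ofReal_le_ofReal ?_
    calc ∫ ω, ‖M n ω‖ ∂μ ≤ ∫ ω, (1 + M n ω ^ 2) ∂μ := by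
          refine integral_mono (hMint n).norm ((integrable_const _).add (hMsq n)) fun ω => ?_
          change |M n ω| ≤ 1 + M n ω ^ 2
          nlinarith [sq_abs (M n ω), sq_nonneg (|M n ω| - 1), abs_nonneg (M n ω)]
      _ = 1 + ∫ ω, M n ω ^ 2 ∂μ := by
          rw [integral_add (integrable_const _) (hMsq n)]
          simp
      _ ≤ 1 + R := by linarith [hR n]
  filter_upwards [hmart.submartingale.exists_ae_tendsto_of_bdd hL1] with ω ⟨c, hc⟩
  exact tendsto_average_zero_of_tendsto_sum_div hc

end StrongLaw

/-! ### Iterated dominance in a finite game -/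

section Dominance

variable {ι : Type*} [DecidableEq ι] {A : ι → Type*} [∀ i, Fintype (A i)]
  {u : (i : ι) → (∀ j, A j) → ℝ}

theorem survivors_antitone (i : ι) : Antitone fun k => survivors u k i :=
  antitone_nat_of_succ_le fun _ _ ha => ha.1

/-- Each eliminated action has a round by which it is gone, and there are finitely many actions in
all. -/
theorem exists_survivors_eq_seriallyUndominated [Finite ι] :
    ∃ k, survivors u k = seriallyUndominated u := by
  have h : ∀ p : Σ i, A i, ∃ k, p.2 ∈ survivors u k p.1 → p.2 ∈ seriallyUndominated u p.1 := by
    rintro ⟨i, a⟩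
    by_cases ha : a ∈ seriallyUndominated u i
    · exact ⟨0, fun _ => ha⟩
    · obtain ⟨k, hk⟩ := not_forall.1 (mt mem_iInter.2 ha)
      exact ⟨k, fun h => absurd h hk⟩
  choose K hK using h
  obtain ⟨k, hk⟩ := Finite.exists_le K
  refine ⟨k, funext fun i => Subset.antisymm (fun a ha => ?_) (iInter_subset _ k)⟩
  exact hK ⟨i, a⟩ (survivors_antitone i (hk ⟨i, a⟩) ha)

/-- By finiteness, a strictly dominating mixed strategy is better by a uniform margin. -/
theorem StrictlyDominated.exists_margin [Finite ι] {S : (i : ι) → Set (A i)} {i : ι} {a : A i}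
    (h : StrictlyDominated u S i a) :
    ∃ x ∈ stdSimplex ℝ (A i), ∃ δ > 0, ∀ b : ∀ j, A j, (∀ j, b j ∈ S j) →
      δ ≤ mixedPayoff u i x b - u i (Function.update b i a) := by
  obtain ⟨x, hx, -, hlt⟩ := h
  refine ⟨x, hx, ?_⟩
  let T := {b : ∀ j, A j // ∀ j, b j ∈ S j}
  let f : T → ℝ := fun b => mixedPayoff u i x b.1 - u i (Function.update b.1 i a)
  cases isEmpty_or_nonempty T with
  | inl hT => exact ⟨1, one_pos, fun b hb => (hT.false ⟨b, hb⟩).elim⟩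
  | inr hT =>
    obtain ⟨b₀, hb₀⟩ := Finite.exists_min f
    exact ⟨f b₀, sub_pos.2 (hlt b₀.1 fun j _ => b₀.2 j), fun b hb => hb₀ ⟨b, hb⟩⟩

end Dominance

/-! ### Time averages -/

section Averages

variable {ι : Type*} {A : ι → Type*}

/-- Rounds outside `S` cost at most `B` each and have frequency zero, so the lower limit of the
averages of `f` is at least `δ`; half of it leaves room for the limit. -/
theorem TimeAverageConverges.eventually_le_sum {a : ℕ → ∀ j, A j} {S : (i : ι) → Set (A i)}
    (h : TimeAverageConverges a S) {f : ℕ → ℝ} {δ B : ℝ} (hδ : 0 < δ)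
    (hf : ∀ s, (∀ i, a s i ∈ S i) → δ ≤ f s) (hB : ∀ s, -B ≤ f s) :
    ∀ᶠ T : ℕ in atTop, δ / 2 * T ≤ ∑ s ∈ Finset.range T, f s := by
  classical
  have h1 := (h.const_mul (δ + B)).sub_const B
  have h2 : δ / 2 < (δ + B) * 1 - B := by linarith
  filter_upwards [h1.eventually_const_lt h2, eventually_gt_atTop 0] with T hT hT0
  have hT0' : (0 : ℝ) < T := by exact_mod_cast hT0
  calc δ / 2 * T ≤ ((δ + B) * (1 / (T : ℝ) *
        ∑ s ∈ Finset.range T, if ∀ i, a s i ∈ S i then (1 : ℝ) else 0) - B) * T := by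
        gcongr
    _ = ∑ s ∈ Finset.range T, ((δ + B) * (if ∀ i, a s i ∈ S i then (1 : ℝ) else 0) - B) := by
        rw [Finset.sum_sub_distrib, ← Finset.mul_sum]
        simp only [Finset.sum_const, Finset.card_range, nsmul_eq_mul]
        field_simp
    _ ≤ ∑ s ∈ Finset.range T, f s := by
        refine Finset.sum_le_sum fun s _ => ?_
        split_ifs with hs
        · linarith [hf s hs]
        · linarith [hB s]

/-- A union bound: a profile outside `S` has some player at one of finitely many excluded actions.
-/
theorem timeAverageConverges_of_tendsto_zero [Fintype ι] [∀ i, Fintype (A i)]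
    {a : ℕ → ∀ j, A j} {S : (i : ι) → Set (A i)}
    (h : ∀ i, ∀ c ∉ S i, Tendsto (fun T : ℕ =>
      (∑ s ∈ Finset.range T, ({c} : Set (A i)).indicator (1 : A i → ℝ) (a s i)) / T) atTop (𝓝 0)) :
    TimeAverageConverges a S := by
  classical
  have h1 : Tendsto (fun T : ℕ => ∑ i, ∑ c : A i, if c ∈ S i then (0 : ℝ) else
      (∑ s ∈ Finset.range T, ({c} : Set (A i)).indicator (1 : A i → ℝ) (a s i)) / T)
      atTop (𝓝 0) := by
    rw [show (0 : ℝ) = ∑ i, ∑ _c : A i, (0 : ℝ) by simp]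
    refine tendsto_finsetSum _ fun i _ => tendsto_finsetSum _ fun c _ => ?_
    by_cases hc : c ∈ S i
    · simp [hc]
    · simpa [hc] using h i c hc
  have h2 := h1.const_sub 1
  rw [sub_zero] at h2
  unfold TimeAverageConverges
  refine tendsto_of_tendsto_of_tendsto_of_le_of_le' h2
    tendsto_const_nhds ?_ ?_
  · filter_upwards [eventually_gt_atTop 0] with T hT
    have hT' : (0 : ℝ) < T := by exact_mod_cast hT
    have key : ∀ s, 1 - ∑ i, ∑ c : A i, (if c ∈ S i then (0 : ℝ) else
        ({c} : Set (A i)).indicator (1 : A i → ℝ) (a s i)) ≤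
        if ∀ i, a s i ∈ S i then (1 : ℝ) else 0 := by
      intro s
      have hnn : ∀ i, ∀ c : A i, 0 ≤ (if c ∈ S i then (0 : ℝ) else
          ({c} : Set (A i)).indicator (1 : A i → ℝ) (a s i)) := by
        intro i c
        split_ifs
        · exact le_rfl
        · exact indicator_nonneg (fun _ _ => zero_le_one) _
      split_ifs with hs
      · exact sub_le_self _ (Finset.sum_nonneg fun i _ => Finset.sum_nonneg fun c _ => hnn i c)
      · obtain ⟨i, hi⟩ := not_forall.1 hs
        have h2 := Finset.single_le_sum (fun c _ => hnn i c) (Finset.mem_univ (a s i))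
        have h3 := Finset.single_le_sum
          (f := fun i => ∑ c : A i, if c ∈ S i then (0 : ℝ) else
            ({c} : Set (A i)).indicator (1 : A i → ℝ) (a s i))
          (fun i _ => Finset.sum_nonneg fun c _ => hnn i c) (Finset.mem_univ i)
        simp only [hi, if_false, indicator_of_mem (mem_singleton (a s i)), Pi.one_apply] at h2
        linarith
    have hsum := Finset.sum_le_sum fun s (_ : s ∈ Finset.range T) => key s
    rw [Finset.sum_sub_distrib, Finset.sum_comm] at hsum
    have e : ∑ i, ∑ c : A i, (if c ∈ S i then (0 : ℝ) else
        (∑ s ∈ Finset.range T, ({c} : Set (A i)).indicator (1 : A i → ℝ) (a s i)) / T) =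
        (∑ i, ∑ s ∈ Finset.range T, ∑ c : A i, (if c ∈ S i then (0 : ℝ) else
          ({c} : Set (A i)).indicator (1 : A i → ℝ) (a s i))) / T := by
      rw [Finset.sum_div]
      refine Finset.sum_congr rfl fun i _ => ?_
      rw [Finset.sum_comm, Finset.sum_div]
      refine Finset.sum_congr rfl fun c _ => ?_
      split_ifs <;> simp
    rw [e, one_div, ← div_eq_inv_mul, le_div_iff₀ hT', sub_mul, div_mul_cancel₀ _ hT'.ne']
    rw [Finset.sum_const, Finset.card_range, nsmul_eq_mul, mul_one, ← one_mul (T : ℝ)] at hsum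
    convert hsum
  · filter_upwards [eventually_gt_atTop 0] with T hT
    have hT' : (0 : ℝ) < T := by exact_mod_cast hT
    rw [one_div, ← div_eq_inv_mul, div_le_one hT']
    calc _ ≤ ∑ _s ∈ Finset.range T, (1 : ℝ) := by
          refine Finset.sum_le_sum fun s _ => ?_
          split_ifs <;> norm_num
      _ = T := by simp

end Averages

/-! ### Average rewards -/

section Rewards

variable {A : Type*}

theorem averageReward_append {m : ℕ} (p : Fin m → A × (A → ℝ)) (q : ℕ → A × (A → ℝ)) (t : ℕ)
    (b : A) : averageReward (Fin.append p fun s : Fin t => q s) b =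
      (∑ s, (p s).2 b + ∑ s ∈ Finset.range t, (q s).2 b) / (m + t : ℕ) := by
  unfold averageReward
  rw [Fin.sum_univ_add, Finset.sum_range]
  simp

/-- If a mixed strategy has linearly more expected reward than `a`, and the rewards average out to
the expected ones, then some action eventually has more average reward than `a`, by a margin that
exceeds any given null sequence. -/
theorem eventually_exists_averageReward_sub_gt [Fintype A] {m : ℕ} (p : Fin m → A × (A → ℝ))
    {q : ℕ → A × (A → ℝ)} {v : ℕ → A → ℝ}
    (hq : ∀ b, Tendsto (fun t : ℕ => (∑ s ∈ Finset.range t, ((q s).2 b - v s b)) / t) atTop (𝓝 0))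
    {x : A → ℝ} (hx : x ∈ stdSimplex ℝ A) {a : A} {δ : ℝ} (hδ : 0 < δ)
    (hv : ∀ᶠ t : ℕ in atTop, δ * t ≤ ∑ s ∈ Finset.range t, (∑ c, x c * v s c - v s a))
    {γ : ℕ → ℝ} (hγ : Tendsto γ atTop (𝓝 0)) :
    ∀ᶠ t : ℕ in atTop, ∃ a', averageReward (Fin.append p fun s : Fin t => q s) a' -
      averageReward (Fin.append p fun s : Fin t => q s) a > γ (m + t + 1) := by
  set E : A → ℕ → ℝ := fun b t => ∑ s, (p s).2 b + ∑ s ∈ Finset.range t, ((q s).2 b - v s b)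
    with hE
  set R : A → ℕ → ℝ := fun b t => ∑ s, (p s).2 b + ∑ s ∈ Finset.range t, (q s).2 b with hR
  have hEt : ∀ b, Tendsto (fun t : ℕ => E b t / t) atTop (𝓝 0) := by
    intro b
    have := (tendsto_const_div_atTop_nhds_zero_nat (∑ s, (p s).2 b)).add (hq b)
    rw [add_zero] at this
    simpa only [hE, add_div] using this
  have hG : Tendsto (fun t : ℕ => ∑ c, x c * (E c t / t) - E a t / t) atTop (𝓝 0) := by
    have h1 : Tendsto (fun t : ℕ => ∑ c, x c * (E c t / t)) atTop (𝓝 (∑ c, x c * 0)) :=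
      tendsto_finsetSum _ fun c _ => (hEt c).const_mul _
    simpa using h1.sub (hEt a)
  -- `E` collects the early rounds and the noise, both `o(t)`; the last sum is the linear advantage.
  have hRE : ∀ t, ∑ c, x c * R c t - R a t = ∑ c, x c * E c t - E a t +
      ∑ s ∈ Finset.range t, (∑ c, x c * v s c - v s a) := by
    intro t
    have h1 : ∀ b, R b t = E b t + ∑ s ∈ Finset.range t, v s b := by
      intro b
      simp only [hR, hE, Finset.sum_sub_distrib]
      ring
    simp only [h1, mul_add, Finset.sum_add_distrib, Finset.sum_sub_distrib, Finset.mul_sum]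
    rw [Finset.sum_comm (s := Finset.range t)]
    ring
  have hγ' : Tendsto (fun t => γ (m + t + 1)) atTop (𝓝 0) :=
    hγ.comp (tendsto_atTop_mono (fun t => show t ≤ m + t + 1 by omega) tendsto_id)
  -- The noise takes at most `δ / 2 * t` of the advantage, so more than `δ / 3 * t` is left.
  -- Dividing by `m + t ≤ 2 * t` leaves at least `δ / 6`, the bound on `γ`.
  filter_upwards [hv, hG.eventually_const_lt (show -(δ / 2) < 0 by linarith),
    hγ'.eventually_lt_const (show 0 < δ / 6 by linarith), eventually_gt_atTop 0,
    eventually_ge_atTop m] with t hvt hGt hγt ht htm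
  have ht' : (0 : ℝ) < t := by exact_mod_cast ht
  have htm' : (m : ℝ) ≤ t := by exact_mod_cast htm
  have hGt' : -(δ / 2) * t < ∑ c, x c * E c t - E a t := by
    rw [← lt_div_iff₀ ht', sub_div, Finset.sum_div]
    simpa only [mul_div_assoc] using hGt
  have hdiff : R a t + δ / 3 * t < ∑ c, x c * R c t := by
    have := hRE t
    nlinarith [mul_pos hδ ht']
  obtain ⟨c, hc⟩ : ∃ c, R a t + δ / 3 * t < R c t := by
    by_contra! hcon
    refine hdiff.not_ge ?_
    calc ∑ c, x c * R c t ≤ ∑ c, x c * (R a t + δ / 3 * t) :=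
          Finset.sum_le_sum fun c _ => mul_le_mul_of_nonneg_left (hcon c) (hx.1 c)
      _ = R a t + δ / 3 * t := by rw [← Finset.sum_mul, hx.2, one_mul]
  refine ⟨c, hγt.trans_le ?_⟩
  rw [averageReward_append, averageReward_append, ← sub_div, le_div_iff₀ (by positivity)]
  push_cast
  change _ ≤ R c t - R a t
  nlinarith

end Rewards

/-! ### Repeated play: measurability -/

section Play

variable {ι : Type*} [DecidableEq ι] {A : ι → Type*} {Ω : Type*} {m : ι → ℕ}
  {prior : (i : ι) → Ω → Fin (m i) → A i × (A i → ℝ)}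
  {U : ℕ → ι → (∀ j, A j) → Ω → ℝ} {act : ℕ → Ω → ∀ j, A j}

theorem playerHistory_succ_castSucc (i : ι) (t : ℕ) (ω : Ω) (s : Fin (m i + t)) :
    playerHistory prior U act i (t + 1) ω s.castSucc = playerHistory prior U act i t ω s := by
  unfold playerHistory
  induction s using Fin.addCases with
  | left s =>
    rw [Fin.append_left]
    exact Fin.append_left _ _ s
  | right s =>
    rw [Fin.append_right]
    exact Fin.append_right _ _ s.castSucc

theorem playerHistory_succ_last (i : ι) (t : ℕ) (ω : Ω) :
    playerHistory prior U act i (t + 1) ω (Fin.last (m i + t)) =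
      (act t ω i, fun b => U t i (Function.update (act t ω) i b) ω) :=
  Fin.append_right _ _ (Fin.last t)

variable [∀ i, MeasurableSpace (A i)]

theorem measurable_playerHistory_past (i : ι) (t : ℕ) :
    Measurable[past prior U act t] (playerHistory prior U act i t) :=
  (comap_measurable _).mono (le_iSup (fun i => MeasurableSpace.comap
    (playerHistory prior U act i t) inferInstance) i) le_rfl

theorem past_mono : Monotone (past prior U act) := by
  refine monotone_nat_of_le_succ fun t => iSup_le fun i => ?_
  refine measurable_iff_comap_le.1 ?_
  have h := measurable_playerHistory_past (prior := prior) (U := U) (act := act) i (t + 1)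
  let _ : MeasurableSpace Ω := past prior U act (t + 1)
  refine measurable_pi_iff.2 fun s => ?_
  have h1 := (measurable_pi_apply s.castSucc).comp h
  exact (congrArg Measurable (funext fun ω => playerHistory_succ_castSucc i t ω s)).mp h1

theorem measurable_action_past_succ (t : ℕ) : Measurable[past prior U act (t + 1)] (act t) := by
  let _ : MeasurableSpace Ω := past prior U act (t + 1)
  refine measurable_pi_iff.2 fun i => ?_
  have h := (measurable_pi_apply (Fin.last (m i + t))).comp
    (measurable_playerHistory_past (prior := prior) (U := U) (act := act) i (t + 1))
  have h1 := measurable_fst.comp h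
  refine (congrArg Measurable (funext fun ω => ?_)).mp h1
  exact congrArg Prod.fst (playerHistory_succ_last (prior := prior) (U := U) i t ω)

theorem measurable_reward_past_succ (i : ι) (t : ℕ) (b : A i) :
    Measurable[past prior U act (t + 1)] fun ω => U t i (Function.update (act t ω) i b) ω := by
  have h := (measurable_pi_apply (Fin.last (m i + t))).comp
    (measurable_playerHistory_past (prior := prior) (U := U) (act := act) i (t + 1))
  have h1 := (measurable_pi_apply b).comp (measurable_snd.comp h)
  refine (congrArg (Measurable[past prior U act (t + 1)]) (funext fun ω => ?_)).mp h1
  exact congrFun (congrArg Prod.snd (playerHistory_succ_last (prior := prior) i t ω)) b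

variable [Finite ι] [∀ i, Fintype (A i)] [∀ i, DiscreteMeasurableSpace (A i)]
  [MeasurableSpace Ω] {μ : Measure Ω} {u : (i : ι) → (∀ j, A j) → ℝ} {lo hi : ℝ}
  {alg : (i : ι) → OnlineAlgorithm (A i)}

namespace IsRepeatedPlay

/-- The random profile takes only finitely many values, so measurability at each fixed profile
suffices. -/
theorem measurable_reward (hplay : IsRepeatedPlay μ u lo hi alg prior U act)
    (i : ι) (t : ℕ) (b : A i) :
    Measurable fun ω => U t i (Function.update (act t ω) i b) ω := by
  have h : Measurable fun p : (∀ j, A j) × Ω => U t i (Function.update p.1 i b) p.2 :=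
    measurable_from_prod_countable_right fun c =>
      hplay.measurable_payoff t i (Function.update c i b)
  exact h.comp ((hplay.measurable_action t).prodMk measurable_id)

theorem past_le (hplay : IsRepeatedPlay μ u lo hi alg prior U act)
    (t : ℕ) : past prior U act t ≤ ‹MeasurableSpace Ω› := by
  refine iSup_le fun i => measurable_iff_comap_le.1 ?_
  refine measurable_pi_iff.2 fun s => ?_
  unfold playerHistory
  induction s using Fin.addCases with
  | left s =>
    simp_rw [Fin.append_left]
    exact (measurable_pi_apply s).comp (hplay.measurable_prior i)
  | right s =>
    simp_rw [Fin.append_right]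
    exact ((measurable_pi_apply i).comp (hplay.measurable_action s)).prodMk
      (measurable_pi_iff.2 fun b => hplay.measurable_reward i s b)

/-- The filtration of the pasts. -/
def filtration (hplay : IsRepeatedPlay μ u lo hi alg prior U act) :
    Filtration ℕ ‹MeasurableSpace Ω› where
  seq := past prior U act
  mono' := past_mono
  le' := hplay.past_le

end IsRepeatedPlay
end Play
/-! ### Repeated play: laws of large numbers -/

/-- Inserting a measurable choice of the index into a finite family of functions with conditional
expectation zero. -/
theorem condExp_apply_eq_zero {Ω : Type*} {G m0 : MeasurableSpace Ω} {μ : Measure Ω}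
    [IsFiniteMeasure μ] (hG : G ≤ m0) {K : Type*} [Fintype K] [MeasurableSpace K]
    [DiscreteMeasurableSpace K] {X : Ω → K} (hX : Measurable[G] X) {V : K → Ω → ℝ}
    (hV : ∀ c, Integrable (V c) μ) (hVG : ∀ c, μ[V c | G] =ᵐ[μ] 0) :
    μ[fun ω => V (X ω) ω | G] =ᵐ[μ] 0 := by
  classical
  let I : K → Ω → ℝ := fun c ω => ({c} : Set K).indicator 1 (X ω)
  have hI : ∀ c, StronglyMeasurable[G] (I c) := by
    intro c
    have h2 : Measurable (({c} : Set K).indicator (1 : K → ℝ)) := Measurable.of_discrete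
    exact (h2.comp hX).stronglyMeasurable
  have hIbd : ∀ c, ∀ᵐ ω ∂μ, ‖I c ω‖ ≤ 1 := fun c => ae_of_all _ fun ω => by
    refine (norm_indicator_le_norm_self _ _).trans ?_
    simp
  have hsum : (fun ω => V (X ω) ω) = ∑ c, I c * V c := by
    ext ω
    rw [Finset.sum_apply, Finset.sum_eq_single (X ω)]
    · simp [I]
    · intro c _ hc
      simp only [I, Pi.mul_apply]
      rw [indicator_of_notMem (fun h => hc (mem_singleton_iff.1 h).symm), zero_mul]
    · simp
  rw [hsum]
  refine (condExp_finsetSum (fun c _ => (hV c).bdd_mul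
    ((hI c).mono hG).aestronglyMeasurable (hIbd c)) G).trans ?_
  have h1 : ∀ c, μ[I c * V c | G] =ᵐ[μ] 0 := by
    intro c
    refine (condExp_stronglyMeasurable_mul_of_bound hG (hI c) (hV c) 1 (hIbd c)).trans ?_
    filter_upwards [hVG c] with ω e
    simp [e]
  filter_upwards [ae_all_iff.2 h1] with ω h
  rw [Finset.sum_apply]
  exact Finset.sum_eq_zero fun c _ => h c

section Play

variable {ι : Type*} [DecidableEq ι] {A : ι → Type*} {Ω : Type*} {m : ι → ℕ}
  {prior : (i : ι) → Ω → Fin (m i) → A i × (A i → ℝ)}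
  {U : ℕ → ι → (∀ j, A j) → Ω → ℝ} {act : ℕ → Ω → ∀ j, A j}
  [∀ i, MeasurableSpace (A i)] [∀ i, Fintype (A i)]
  [MeasurableSpace Ω] {μ : Measure Ω} [IsProbabilityMeasure μ]
  {u : (i : ι) → (∀ j, A j) → ℝ} {lo hi : ℝ}
  {alg : (i : ι) → OnlineAlgorithm (A i)}

namespace IsRepeatedPlay

theorem integrable_payoff (hplay : IsRepeatedPlay μ u lo hi alg prior U act)
    (t : ℕ) (i : ι) (a : ∀ j, A j) : Integrable (U t i a) μ := by
  refine Integrable.of_bound (hplay.measurable_payoff t i a).aestronglyMeasurable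
    (max |lo| |hi|) ?_
  filter_upwards [hplay.payoff_mem t i a] with ω h
  exact abs_le_max_abs_abs h.1 h.2

variable [Fintype ι] [∀ i, DiscreteMeasurableSpace (A i)]

/-- Given the past, the rewards have the expectations that the actions of the others determine. -/
theorem condExp_reward_sub_eq_zero (hplay : IsRepeatedPlay μ u lo hi alg prior U act)
    (i : ι) (t : ℕ) (b : A i) :
    μ[fun ω => U t i (Function.update (act t ω) i b) ω - u i (Function.update (act t ω) i b) |
      past prior U act t] =ᵐ[μ] 0 := by
  -- Conditioning also on the current profile makes the index of the payoff known, while the payoffs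
  -- stay independent; the tower property then returns to the past.
  have hGle : past prior U act t ⊔ MeasurableSpace.comap (act t) inferInstance ≤
      ‹MeasurableSpace Ω› :=
    sup_le (hplay.past_le t) (hplay.measurable_action t).comap_le
  have hzero := condExp_apply_eq_zero (μ := μ) hGle
    ((comap_measurable (act t)).mono le_sup_right le_rfl)
    (V := fun c ω => U t i (Function.update c i b) ω - u i (Function.update c i b))
    (fun c => (hplay.integrable_payoff t i _).sub (integrable_const _)) (fun c => ?_)
  · refine (condExp_condExp_of_le (μ := μ) le_sup_left hGle).symm.trans ?_
    exact (condExp_congr_ae hzero).trans (by rw [condExp_zero])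
  · have h1 := condExp_indep_eq (hplay.measurable_payoff t i (Function.update c i b)).comap_le
      hGle (comap_measurable _).stronglyMeasurable
      (hplay.payoff_indep t i (Function.update c i b))
    have h2 := condExp_sub (hplay.integrable_payoff t i (Function.update c i b))
      (integrable_const (μ := μ) (u i (Function.update c i b)))
      (past prior U act t ⊔ MeasurableSpace.comap (act t) inferInstance)
    rw [condExp_const hGle] at h2
    refine h2.trans ?_
    filter_upwards [h1] with ω e
    simp [e, hplay.payoff_mean]

/-- The rewards average out to their expectations. -/
theorem ae_tendsto_average_reward_sub (hplay : IsRepeatedPlay μ u lo hi alg prior U act)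
    (i : ι) (b : A i) :
    ∀ᵐ ω ∂μ, Tendsto (fun n : ℕ => (∑ t ∈ Finset.range n,
      (U t i (Function.update (act t ω) i b) ω - u i (Function.update (act t ω) i b))) / n)
      atTop (𝓝 0) := by
  obtain ⟨B, hB⟩ := Finite.exists_le fun c => |u i c|
  refine ae_tendsto_average_zero_of_condExp_eq_zero hplay.filtration (C := max |lo| |hi| + B)
    (D := fun t ω => U t i (Function.update (act t ω) i b) ω -
      u i (Function.update (act t ω) i b)) (fun t => ?_) (fun t => ?_)
    (fun t => hplay.condExp_reward_sub_eq_zero i t b)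
  · have h1 : Measurable fun c => u i (Function.update c i b) := Measurable.of_discrete
    exact ((measurable_reward_past_succ i t b).sub
      (h1.comp (measurable_action_past_succ t))).stronglyMeasurable
  · filter_upwards [ae_all_iff.2 fun c => hplay.payoff_mem t i c] with ω h
    exact (abs_sub _ _).trans (add_le_add (abs_le_max_abs_abs (h _).1 (h _).2) (hB _))

/-- The frequency of an action is asymptotically the average of the probabilities with which the
algorithm picks it. -/
theorem ae_tendsto_average_action_sub (hplay : IsRepeatedPlay μ u lo hi alg prior U act)
    (i : ι) (a : A i) :
    ∀ᵐ ω ∂μ, Tendsto (fun n : ℕ => (∑ t ∈ Finset.range n,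
      (({a} : Set (A i)).indicator 1 (act t ω i) -
        (alg i (m i + t) (playerHistory prior U act i t ω)).1 a)) / n) atTop (𝓝 0) := by
  let I : ℕ → Ω → ℝ := fun t => {ω | act t ω i = a}.indicator fun _ => 1
  have hI : ∀ t ω, I t ω = ({a} : Set (A i)).indicator 1 (act t ω i) := fun t ω => rfl
  have hmeas : ∀ t, StronglyMeasurable[past prior U act (t + 1)] (I t) := by
    intro t
    have h1 : Measurable fun c : ∀ j, A j => ({a} : Set (A i)).indicator (1 : A i → ℝ) (c i) :=
      Measurable.of_discrete
    exact (h1.comp (measurable_action_past_succ t)).stronglyMeasurable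
  have hbd : ∀ t, ∀ᵐ ω ∂μ, |I t ω| ≤ 1 := fun t => ae_of_all _ fun ω => by
    refine (norm_indicator_le_norm_self (fun _ => (1 : ℝ)) ω).trans ?_
    simp
  have hint : ∀ t, Integrable (I t) μ := fun t => Integrable.of_bound
    ((hmeas t).mono (hplay.past_le _)).aestronglyMeasurable 1 (hbd t)
  have h := ae_tendsto_average_zero_of_condExp_eq_zero hplay.filtration (C := 1 + 1) (μ := μ)
    (D := fun t => I t - μ[I t | past prior U act t]) (fun t => ?_) (fun t => ?_) (fun t => ?_)
  · filter_upwards [h, ae_all_iff.2 fun t => hplay.action_law t i a] with ω h1 h2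
    refine h1.congr fun n => ?_
    congr 1
    refine Finset.sum_congr rfl fun t _ => ?_
    rw [Pi.sub_apply, ← hI, ← h2 t]
  · exact (hmeas t).sub (stronglyMeasurable_condExp.mono (past_mono t.le_succ))
  · filter_upwards [hbd t, ae_bdd_abs_condExp_of_ae_bdd_abs (m := past prior U act t) (hbd t)]
      with ω h1 h2
    exact (abs_sub _ _).trans (add_le_add h1 h2)
  · change μ[I t - μ[I t | past prior U act t] | past prior U act t] =ᵐ[μ] 0
    refine (condExp_sub (hint t) integrable_condExp _).trans ?_
    rw [condExp_of_stronglyMeasurable (hplay.past_le t) stronglyMeasurable_condExp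
      integrable_condExp, sub_self]

/-- Actions that do not survive `k` rounds of iterated strict dominance are played with asymptotic
frequency zero. -/
theorem ae_tendsto_average_action_zero (hplay : IsRepeatedPlay μ u lo hi alg prior U act)
    (halg : ∀ i, IsMeanBased lo hi (alg i)) (k : ℕ) :
    ∀ᵐ ω ∂μ, ∀ i, ∀ c ∉ survivors u k i, Tendsto (fun T : ℕ =>
      (∑ t ∈ Finset.range T, ({c} : Set (A i)).indicator (1 : A i → ℝ) (act t ω i)) / T)
      atTop (𝓝 0) := by
  induction k with
  | zero => exact ae_of_all _ fun ω i c hc => absurd (mem_univ c) hc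
  | succ k ih =>
    filter_upwards [ih, ae_all_iff.2 fun i => hplay.prior_mem i,
      ae_all_iff.2 fun t => ae_all_iff.2 fun i => ae_all_iff.2 fun c => hplay.payoff_mem t i c,
      ae_all_iff.2 fun i => ae_all_iff.2 fun b => hplay.ae_tendsto_average_reward_sub i b,
      ae_all_iff.2 fun i => ae_all_iff.2 fun b => hplay.ae_tendsto_average_action_sub i b]
      with ω hfreq hprior hpayoff hreward haction i a ha
    by_cases hak : a ∈ survivors u k i
    swap
    · exact hfreq i a hak
    have hdom : StrictlyDominated u (survivors u k) i a := by
      by_contra hcon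
      exact ha ⟨hak, hcon⟩
    obtain ⟨x, hx, δ, hδ, hmargin⟩ := hdom.exists_margin
    obtain ⟨γ, -, hγ, hmean⟩ := halg i
    obtain ⟨B, hB⟩ := Finite.exists_le fun b : ∀ j, A j =>
      -(mixedPayoff u i x b - u i (Function.update b i a))
    -- The induction hypothesis enters here: play is in `survivors u k` at frequency one, where the
    -- margin `δ` holds.
    have hgap := (timeAverageConverges_of_tendsto_zero hfreq).eventually_le_sum hδ
      (f := fun s => mixedPayoff u i x (act s ω) - u i (Function.update (act s ω) i a))
      (fun s hs => hmargin _ hs) (fun s => neg_le.1 (hB (act s ω)))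
    have hbetter := eventually_exists_averageReward_sub_gt (prior i ω)
      (q := fun s => (act s ω i, fun b => U s i (Function.update (act s ω) i b) ω))
      (v := fun s b => u i (Function.update (act s ω) i b)) (hreward i) hx (half_pos hδ) hgap hγ
    have hprob : Tendsto (fun t => (alg i (m i + t) (playerHistory prior U act i t ω)).1 a)
        atTop (𝓝 0) := by
      have hγ' : Tendsto (fun t => γ (m i + t + 1)) atTop (𝓝 0) :=
        hγ.comp (tendsto_atTop_mono (fun t => show t ≤ m i + t + 1 by omega) tendsto_id)
      refine tendsto_of_tendsto_of_tendsto_of_le_of_le' tendsto_const_nhds hγ'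
        (Eventually.of_forall fun t => (alg i _ _).2.1 a) ?_
      filter_upwards [hbetter] with t ht
      refine hmean _ _ (fun s b => ?_) a ht
      unfold playerHistory
      induction s using Fin.addCases with
      | left s => simpa only [Fin.append_left] using hprior i s b
      | right s => simpa only [Fin.append_right] using hpayoff s i _
    -- Vanishing probabilities have vanishing averages, and the frequency of `a` follows these
    -- averages.
    have hsum := (haction i a).add hprob.cesaro
    rw [add_zero] at hsum
    refine hsum.congr fun T => ?_
    rw [← div_eq_inv_mul, ← add_div, ← Finset.sum_add_distrib]
    simp only [sub_add_cancel]

end IsRepeatedPlay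
end Play
end MeanBased

theorem mainTheorem4 {ι : Type*} [Fintype ι] [DecidableEq ι]
    {A : ι → Type*} [∀ i, Fintype (A i)] [∀ i, MeasurableSpace (A i)]
    [∀ i, DiscreteMeasurableSpace (A i)]
    {Ω : Type*} [MeasurableSpace Ω] (μ : Measure Ω) [IsProbabilityMeasure μ]
    (u : (i : ι) → (∀ j, A j) → ℝ) (lo hi : ℝ)
    (alg : (i : ι) → MeanBased.OnlineAlgorithm (A i))
    (halg : ∀ i, MeanBased.IsMeanBased lo hi (alg i))
    (m : ι → ℕ) (prior : (i : ι) → Ω → Fin (m i) → A i × (A i → ℝ))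
    (U : ℕ → ι → (∀ j, A j) → Ω → ℝ) (act : ℕ → Ω → ∀ j, A j)
    (hplay : MeanBased.IsRepeatedPlay μ u lo hi alg prior U act) :
    ∀ᵐ ω ∂μ, MeanBased.TimeAverageConverges (fun t => act t ω)
      (MeanBased.seriallyUndominated u) := by
  obtain ⟨k, hk⟩ := MeanBased.exists_survivors_eq_seriallyUndominated (u := u)
  rw [← hk]
  filter_upwards [hplay.ae_tendsto_average_action_zero halg k] with ω hω
  exact MeanBased.timeAverageConverges_of_tendsto_zero hω
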